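/- A ribbon graph $G=(V,E)$ is a (possibly disconnected or non-orientable) surface with boundary, presented as the union of a finite set $V$ of discs (vertices) and a finite set $E$ of discs (edges), such that vertices and edges meet in disjoint line segments, each segment lies on the boundary of exactly one vertex and exactly one edge, and every edge contains exactly two such segments. Ribbon graphs are considered up to equivalence. For $A\subseteq E$ let $k(A)$ and $f(A)$ denote the number of connected components and of boundary components of the spanning ribbon subgraph $(V,A)$, and put $k(G)=k(E)$, $f(G)=f(E)$. The Euler genus of $G$ is $\gamma(G)=2k(G)-|V|+|E|-f(G)$, and $G$ is plane if $\gamma(G)=0$. The geometric dual $G^*$ has the same edges as $G$, and its vertices are discs glued to the boundary components of $G$ (the vertex discs of $G$ being removed). A set system is a pair $D=(E,\mathcal F)$ with $E$ finite and $\mathcal F$ a collection of subsets of $E$, called feasible sets; $D_{\min}$ and $D_{\max}$ are the set systems on $E$ consisting of the feasible sets of minimum, respectively maximum, cardinality, and the dual is $D^*=(E,\{E\setminus X : X\in\mathcal F\})$. A delta-matroid is a set system with $\mathcal F\ne\emptyset$ such that for all $X,Y\in\mathcal F$ and $u\in X\bigtriangleup Y$ there is $v\in X\bigtriangleup Y$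 (possibly $v=u$) with $X\bigtriangleup\{u,v\}\in\mathcal F$; it is a matroid, with $\mathcal F$ its set of bases, if all feasible sets have the same cardinality. For a ribbon graph $G=(V,E)$, let $M(G)$ be its cycle matroid, i.e. the set system on $E$ whose feasible sets are the edge sets of the maximal spanning forests of the underlying graph of $G$, and let $D(G)=(E,\{A\subseteq E : f(A)=k(G)\})$, whose feasible sets are the edge sets of the spanning quasi-trees of $G$. **Corollary.** Let $G$ be a ribbon graph. Then 1. $D(G)_{\min}=M(G)$; 2. $D(G)_{\max}=(M(G^*))^*$; 3. $D(G)=M(G)$ if and only if $G$ is plane; and if $G$ is not plane, then $D(G)$ is not a matroid. -/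

import Mathlib

/-- A set system `(E, 𝓕)` whose ground set consists of all elements of the type `E`. -/
@[ext]
structure SetSystem (E : Type*) where
  /-- The collection `𝓕` of feasible sets. -/
  feasible : Set (Set E)

namespace SetSystem

variable {E : Type*}

/-- The symmetric exchange axiom: for feasible `X, Y` and `u ∈ X ∆ Y` there is `v ∈ X ∆ Y`
(possibly `v = u`) such that `X ∆ {u, v}` is feasible. -/
def SymmetricExchange (D : SetSystem E) : Prop :=
  ∀ X ∈ D.feasible, ∀ Y ∈ D.feasible, ∀ u ∈ symmDiff X Y,
    ∃ v ∈ symmDiff X Y, symmDiff X {u, v} ∈ D.feasible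

/-- A delta-matroid is a proper set system satisfying the symmetric exchange axiom. -/
def IsDeltaMatroid (D : SetSystem E) : Prop :=
  D.feasible.Nonempty ∧ D.SymmetricExchange

/-- A matroid, given by its collection of bases, is a delta-matroid whose feasible sets all have
the same cardinality. -/
def IsMatroid (D : SetSystem E) : Prop :=
  D.IsDeltaMatroid ∧ ∀ X ∈ D.feasible, ∀ Y ∈ D.feasible, X.ncard = Y.ncard

/-- `D_min`: the feasible sets of minimum cardinality. -/
def lower (D : SetSystem E) : SetSystem E where
  feasible := {F | F ∈ D.feasible ∧ ∀ F' ∈ D.feasible, F.ncard ≤ F'.ncard}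

/-- `D_max`: the feasible sets of maximum cardinality. -/
def upper (D : SetSystem E) : SetSystem E where
  feasible := {F | F ∈ D.feasible ∧ ∀ F' ∈ D.feasible, F'.ncard ≤ F.ncard}

/-- The twist `D * A`, with feasible sets `A ∆ X` for `X` feasible in `D`. -/
def twist (D : SetSystem E) (A : Set E) : SetSystem E where
  feasible := {F | ∃ X ∈ D.feasible, F = symmDiff A X}

/-- The dual `D* = D * E`. -/
def dual (D : SetSystem E) : SetSystem E := D.twist Set.univ

end SetSystem

/-- The corners of the edge discs. The boundary circle of an edge disc `e` is made up of two line
segments along which `e` meets vertices (its two *ends*) and of two free arcs (its two *sides*),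
alternately. The corner `(e, i, s)` is the point of `e` where the end `i` and the side `s` meet. -/
abbrev Corner (E : Type*) : Type _ := E × Bool × Bool

namespace Corner

variable {E : Type*}

/-- The corner reached by walking along the side `s` of the edge disc, to its other end. -/
def alongSide (x : Corner E) : Corner E := (x.1, !x.2.1, x.2.2)

/-- The corner reached by walking along the end `i` of the edge disc, to its other side. -/
def alongEnd (x : Corner E) : Corner E := (x.1, x.2.1, !x.2.2)

/-- Interchange the roles of the ends and the sides of an edge disc. -/
def swap (x : Corner E) : Corner E := (x.1, x.2.2, x.2.1)

@[simp]
theorem swap_swap (x : Corner E) : x.swap.swap = x := rfl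

end Corner

/-- A ribbon graph with vertex discs `V` and edge discs `E`, not necessarily connected or
orientable, described (up to equivalence) by how the edge discs are attached to the vertex discs.

The boundary circle of a vertex disc that meets at least one edge consists alternately of line
segments (ends of edges) and of arcs between consecutive line segments. Every corner of an edge is
an endpoint of exactly one such arc; `arc` sends it to the other endpoint of this arc, and `vert`
sends it to the vertex disc it lies on. Two corners lie on the same vertex disc exactly if one
gets from one to the other by walking along arcs and along ends of edges, because the boundary of
the disc is a single circle. The elements of `V` outside the range of `vert` are the isolated
vertices, discs that meet no edge. -/
structure RibbonGraph (V E : Type*) where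
  arc : Corner E → Corner E
  arc_arc : ∀ x, arc (arc x) = x
  arc_ne : ∀ x, arc x ≠ x
  vert : Corner E → V
  vert_eq_iff : ∀ x y, vert x = vert y ↔
    Relation.EqvGen (fun a b => b = arc a ∨ b = a.alongEnd) x y

namespace RibbonGraph

variable {V E : Type*}

/-- The edge `e` joins the vertices `u` and `v` (in either order; `u = v` for a loop). -/
def IsLink (G : RibbonGraph V E) (e : E) (u v : V) : Prop :=
  ∃ i : Bool, G.vert (e, i, false) = u ∧ G.vert (e, !i, false) = v

/-- The connected components of the spanning ribbon subgraph `(V, A)`. -/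
abbrev Component (G : RibbonGraph V E) (A : Set E) : Type _ :=
  Quot fun u v : V => ∃ e ∈ A, G.IsLink e u v

/-- `k(A)`: the number of connected components of `(V, A)`. -/
noncomputable def k (G : RibbonGraph V E) (A : Set E) : ℕ := Nat.card (G.Component A)

/-- At a corner of `e`, the boundary of the surface `(V, A)` leaves the arc of the vertex disc. It
follows the side of `e` if `e` is present, i.e. `e ∈ A`; if `e` has been removed, it follows the
line segment on the boundary of the vertex disc to which `e` was attached. -/
noncomputable def boundaryStep (A : Set E) (x : Corner E) : Corner E :=
  open Classical in if x.1 ∈ A then x.alongSide else x.alongEnd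

/-- The boundary components of the surface `(V, A)`: the closed curves that follow arcs and
`boundaryStep`s alternately, together with the boundary circles of the isolated vertices of `G`. -/
abbrev BoundaryComponent (G : RibbonGraph V E) (A : Set E) : Type _ :=
  (Quot fun x y : Corner E => y = G.arc x ∨ y = boundaryStep A x) ⊕ {v : V // v ∉ Set.range G.vert}

/-- `f(A)`: the number of boundary components of `(V, A)`. -/
noncomputable def f (G : RibbonGraph V E) (A : Set E) : ℕ := Nat.card (G.BoundaryComponent A)

/-- The Euler genus `γ(G) = 2k(G) - χ`, where `χ = v(G) - e(G) + f(G)` is the Euler characteristic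
of the closed surface obtained from `G` by gluing a disc to each boundary component. -/
noncomputable def eulerGenus (G : RibbonGraph V E) : ℤ :=
  2 * G.k Set.univ - (Nat.card V - Nat.card E + G.f Set.univ)

/-- A ribbon graph is plane if its Euler genus is zero (it may be disconnected). -/
def IsPlane (G : RibbonGraph V E) : Prop := G.eulerGenus = 0

/-- The geometric dual `G*`: the boundary components of `G` are capped off with discs, which are
the vertices of `G*`, and the vertex discs of `G` are removed. The edge discs remain the same, but
their sides become ends and conversely; an isolated vertex yields an isolated vertex. -/
def dual (G : RibbonGraph V E) : RibbonGraph (G.BoundaryComponent Set.univ) E where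
  arc x := (G.arc x.swap).swap
  arc_arc x := by simp [G.arc_arc]
  arc_ne x h := G.arc_ne x.swap (by simpa using congrArg Corner.swap h)
  vert x := Sum.inl (Quot.mk _ x.swap)
  vert_eq_iff x y := by
    have key : ∀ a b : Corner E,
        (b.swap = G.arc a.swap ∨ b.swap = boundaryStep Set.univ a.swap) ↔
          (b = (G.arc a.swap).swap ∨ b = a.alongEnd) := by
      intro a b
      have h : boundaryStep Set.univ a.swap = a.alongEnd.swap := by
        simp [boundaryStep, Corner.swap, Corner.alongEnd, Corner.alongSide]
      have hinj : ∀ c d : Corner E, c.swap = d ↔ c = d.swap := fun c d =>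
        ⟨fun h => by rw [← h, Corner.swap_swap], fun h => by rw [h, Corner.swap_swap]⟩
      rw [h, hinj, hinj, Corner.swap_swap]
    rw [Sum.inl.injEq, Quot.eq]
    constructor
    · intro h
      have aux : ∀ p q : Corner E, Relation.EqvGen
          (fun x y => y = G.arc x ∨ y = boundaryStep Set.univ x) p q →
          Relation.EqvGen (fun a b => b = (G.arc a.swap).swap ∨ b = a.alongEnd)
            p.swap q.swap := by
        intro p q h
        induction h with
        | rel p q h => exact .rel _ _ ((key p.swap q.swap).1 h)
        | refl p => exact .refl _
        | symm p q _ ih => exact .symm _ _ ih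
        | trans p q r _ _ ih₁ ih₂ => exact .trans _ _ _ ih₁ ih₂
      exact aux _ _ h
    · intro h
      induction h with
      | rel p q h => exact .rel _ _ ((key p q).2 h)
      | refl p => exact .refl _
      | symm p q _ ih => exact .symm _ _ ih
      | trans p q r _ _ ih₁ ih₂ => exact .trans _ _ _ ih₁ ih₂

/-- `A` contains the edges of a cycle of the underlying graph: distinct vertices `v₀, …, vₙ` and
distinct edges `e₀, …, eₙ` in `A` with `eᵢ` joining `vᵢ` and `vᵢ₊₁` (indices modulo `n + 1`). A
cycle with one edge is a loop, a cycle with two edges is a pair of parallel edges. -/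
def ContainsCycle (G : RibbonGraph V E) (A : Set E) : Prop :=
  ∃ (n : ℕ) (v : Fin (n + 1) → V) (e : Fin (n + 1) → E),
    Function.Injective v ∧ Function.Injective e ∧
      ∀ i, e i ∈ A ∧ G.IsLink (e i) (v i) (v (i + 1))

/-- The spanning subgraph `(V, A)` of the underlying graph is a forest. -/
def IsForest (G : RibbonGraph V E) (A : Set E) : Prop := ¬ G.ContainsCycle A

/-- The cycle matroid `M(G)` of the underlying graph: its bases are the edge sets of the maximal
spanning forests. -/
def cycleMatroid (G : RibbonGraph V E) : SetSystem E where
  feasible := {B | Maximal G.IsForest B}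

/-- The delta-matroid `D(G)`: `A` is feasible if `f(A) = k(G)`, i.e. if `(V, A)` is a spanning
quasi-tree of `G` (it has one boundary component in each connected component of `G`). -/
def deltaMatroid (G : RibbonGraph V E) : SetSystem E where
  feasible := {A | G.f A = G.k Set.univ}

end RibbonGraph

/-!
For every edge set `A`, `|V| ≤ k(A) + |A|` because an edge joins at most two components, and
`k(A) ≤ f(A)` because every component has a boundary. Adding a bridge to a surface merges the two
boundary components it meets, hence `f(A) + |A| ≤ |V|` for a forest `A`, and all three numbers
agree. So a quasi-tree has at least `|V| - k(G)` edges, with equality exactly for the maximal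
spanning forests. Exchanging the sides and ends of all edges shows that `D(G*) = D(G)*`, which turns
this into the description of the largest quasi-trees; they are larger than the smallest ones by
`γ(G)`.
-/

theorem natCard_lt_of_surjective_not_injective {α β : Type*} [Finite α] {q : α → β}
    (hq : Function.Surjective q) (hq' : ¬ Function.Injective q) : Nat.card β < Nat.card α :=
  lt_of_not_ge fun h => hq' (hq.bijective_of_nat_card_le h).1

section Involutions

variable {X : Type*} {C : Set X} {α β : X → X}

theorem even_ncard_of_involutive_of_ne (hC : C.Finite) (hα : Function.Involutive α)
    (hne : ∀ x, α x ≠ x) (hαC : Set.MapsTo α C C) : Even C.ncard := by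
  have hsum : ∑ _x ∈ hC.toFinset, (1 : ZMod 2) = 0 :=
    Finset.sum_involution (fun x _ => α x) (fun _ _ => by decide) (fun x _ _ => hne x)
      (fun x hx => hC.mem_toFinset.2 (hαC (hC.mem_toFinset.1 hx))) (fun x _ => hα x)
  rw [Set.ncard_eq_toFinset_card C hC, ← ZMod.natCast_eq_zero_iff_even]
  simpa using hsum

/-- A curve that follows `α` and `β` alternately, except that it stops in `S` before following `β`,
has both its endpoints in `S` or is closed. -/
theorem even_ncard_inter_of_involutive_of_ne (hC : C.Finite) (S : Set X)
    (hα : Function.Involutive α) (hαne : ∀ x, α x ≠ x) (hαC : Set.MapsTo α C C)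
    (hβ : Function.Involutive β) (hβne : ∀ x, β x ≠ x) (hβC : Set.MapsTo β (C \ S) (C \ S)) :
    Even (C ∩ S).ncard := by
  have h := even_ncard_of_involutive_of_ne hC hα hαne hαC
  rw [← Set.ncard_inter_add_ncard_sdiff_eq_ncard C S hC] at h
  exact (Nat.even_add.1 h).2 (even_ncard_of_involutive_of_ne hC.sdiff hβ hβne hβC)

end Involutions

namespace SetSystem

variable {E : Type*} {D : SetSystem E}

theorem mem_dual_feasible {A : Set E} : A ∈ D.dual.feasible ↔ Aᶜ ∈ D.feasible := by
  have h (X : Set E) : symmDiff Set.univ X = Xᶜ := top_symmDiff X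
  constructor
  · rintro ⟨X, hX, rfl⟩
    rwa [h, compl_compl]
  · intro hA
    exact ⟨Aᶜ, hA, by rw [h, compl_compl]⟩

theorem dual_dual (D : SetSystem E) : D.dual.dual = D := by
  ext A
  rw [mem_dual_feasible, mem_dual_feasible, compl_compl]

theorem lower_dual [Finite E] (D : SetSystem E) : D.dual.lower = D.upper.dual := by
  ext A
  rw [mem_dual_feasible]
  refine and_congr mem_dual_feasible (compl_surjective.forall.trans (forall_congr' fun F => ?_))
  rw [mem_dual_feasible, compl_compl]
  have := Set.ncard_add_ncard_compl A
  have := Set.ncard_add_ncard_compl F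
  exact imp_congr_right fun _ => by omega

theorem lower_eq_self_iff :
    D.lower = D ↔ ∀ X ∈ D.feasible, ∀ Y ∈ D.feasible, X.ncard = Y.ncard := by
  constructor
  · intro h
    have hle : ∀ X ∈ D.feasible, ∀ Y ∈ D.feasible, X.ncard ≤ Y.ncard := fun X hX =>
      (show X ∈ D.lower.feasible by rwa [h]).2
    exact fun X hX Y hY => le_antisymm (hle X hX Y hY) (hle Y hY X hX)
  · intro h
    ext X
    exact ⟨And.left, fun hX => ⟨hX, fun Y hY => (h X hX Y hY).le⟩⟩

end SetSystem

theorem Corner.eq_or_eq_of_fst_eq {E : Type*} {x y : Corner E} (h : y.1 = x.1) :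
    y = x ∨ y = x.alongEnd ∨ y = x.alongSide ∨ y = x.alongSide.alongEnd := by
  obtain ⟨e, i, s⟩ := x
  obtain ⟨e', j, t⟩ := y
  obtain rfl : e' = e := h
  cases i <;> cases j <;> cases s <;> cases t <;> simp [alongEnd, alongSide]

namespace RibbonGraph

variable {V E : Type*}

section Incidence

theorem vert_arc (G : RibbonGraph V E) (x : Corner E) : G.vert (G.arc x) = G.vert x :=
  (G.vert_eq_iff _ _).2 (.symm _ _ (.rel _ _ (.inl rfl)))

theorem vert_alongEnd (G : RibbonGraph V E) (x : Corner E) : G.vert x.alongEnd = G.vert x :=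
  (G.vert_eq_iff _ _).2 (.symm _ _ (.rel _ _ (.inr rfl)))

theorem vert_mk (G : RibbonGraph V E) (e : E) (i s : Bool) :
    G.vert (e, i, s) = G.vert (e, i, false) := by
  cases s
  · rfl
  · exact G.vert_alongEnd (e, i, false)

theorem isLink_vert (G : RibbonGraph V E) (x : Corner E) :
    G.IsLink x.1 (G.vert x) (G.vert x.alongSide) :=
  ⟨x.2.1, (G.vert_mk _ _ _).symm, (G.vert_mk _ _ _).symm⟩

variable {G : RibbonGraph V E} {e : E} {u v u' v' : V}

theorem IsLink.symm (h : G.IsLink e u v) : G.IsLink e v u := by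
  obtain ⟨i, rfl, rfl⟩ := h
  exact ⟨!i, rfl, by rw [Bool.not_not]⟩

theorem IsLink.sym2_eq (h : G.IsLink e u v) (h' : G.IsLink e u' v') : s(u, v) = s(u', v') := by
  obtain ⟨i, rfl, rfl⟩ := h
  obtain ⟨j, rfl, rfl⟩ := h'
  cases i <;> cases j <;> simp [Sym2.eq_swap]

end Incidence

section Components

/-- The component of `(V, A)` containing the vertex `v`. -/
def toComponent (G : RibbonGraph V E) (A : Set E) (v : V) : G.Component A := Quot.mk _ v

/-- The two ends of `e` lie in the same component of `(V, A)`. For `e ∉ A` this says that `e` is not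
a bridge of `(V, A ∪ {e})`. -/
def EndsJoined (G : RibbonGraph V E) (A : Set E) (e : E) : Prop :=
  G.toComponent A (G.vert (e, false, false)) = G.toComponent A (G.vert (e, true, false))

variable {G : RibbonGraph V E} {A B : Set E} {e : E} {u v : V}

theorem toComponent_surjective : Function.Surjective (G.toComponent A) := Quot.mk_surjective

theorem IsLink.toComponent_eq (h : G.IsLink e u v) (he : e ∈ A) :
    G.toComponent A u = G.toComponent A v := Quot.sound ⟨e, he, h⟩

theorem IsLink.toComponent_eq_iff (h : G.IsLink e u v) :
    G.toComponent A u = G.toComponent A v ↔ G.EndsJoined A e := by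
  obtain ⟨i, rfl, rfl⟩ := h
  cases i
  · rfl
  · exact eq_comm

theorem endsJoined_of_mem (he : e ∈ A) : G.EndsJoined A e :=
  (G.isLink_vert (e, false, false)).toComponent_eq he

/-- The map of components induced by the identity of `V`, if every edge in `A` is redundant
for the components of `(V, B)`. -/
def componentMap (h : ∀ e ∈ A, G.EndsJoined B e) : G.Component A → G.Component B :=
  Quot.lift (G.toComponent B) fun _ _ ⟨e, he, hl⟩ => hl.toComponent_eq_iff.2 (h e he)

theorem componentMap_surjective (h : ∀ e ∈ A, G.EndsJoined B e) :
    Function.Surjective (componentMap h) := fun c =>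
  let ⟨v, hv⟩ := toComponent_surjective c
  ⟨G.toComponent A v, hv⟩

theorem k_empty (G : RibbonGraph V E) : G.k ∅ = Nat.card V := by
  have hinj : Function.Injective (G.toComponent ∅) :=
    Function.LeftInverse.injective (g := Quot.lift id fun _ _ ⟨_, he, _⟩ => he.elim) fun _ => rfl
  exact (Nat.card_eq_of_bijective _ ⟨hinj, toComponent_surjective⟩).symm

variable [Finite V]

theorem k_le_of_endsJoined (h : ∀ e ∈ A, G.EndsJoined B e) : G.k B ≤ G.k A :=
  Nat.card_le_card_of_surjective _ (componentMap_surjective h)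

theorem k_anti (h : A ⊆ B) : G.k B ≤ G.k A :=
  k_le_of_endsJoined fun _ he => endsJoined_of_mem (h he)

theorem k_insert_lt (h : ¬ G.EndsJoined A e) : G.k (insert e A) < G.k A := by
  have hA : ∀ e' ∈ A, G.EndsJoined (insert e A) e' := fun _ he' =>
    endsJoined_of_mem (Set.mem_insert_of_mem e he')
  exact natCard_lt_of_surjective_not_injective (componentMap_surjective hA) fun hinj =>
    h (hinj (endsJoined_of_mem (Set.mem_insert e A)))

theorem k_le_k_insert_add_one (G : RibbonGraph V E) (A : Set E) (e : E) :
    G.k A ≤ G.k (insert e A) + 1 := by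
  classical
  let p := G.toComponent A (G.vert (e, false, false))
  let p' := G.toComponent A (G.vert (e, true, false))
  let merge : G.Component A → G.Component A := Function.update id p p'
  have merge_apply : ∀ c ≠ p, merge c = c := fun c hc => Function.update_of_ne hc p' id
  have merge_ends : merge p = merge p' := by
    by_cases h : p' = p
    · rw [h]
    · rw [merge_apply p' h]
      exact Function.update_self p p' id
  let r : G.Component (insert e A) → G.Component A :=
    Quot.lift (fun v => merge (G.toComponent A v)) (by
      rintro u v ⟨e', rfl | he', hl⟩
      · obtain ⟨i, rfl, rfl⟩ := hl
        cases i
        · exact merge_ends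
        · exact merge_ends.symm
      · exact congrArg merge (hl.toComponent_eq he'))
  have hr : Function.Surjective (fun c : Option (G.Component (insert e A)) => c.elim p r) := by
    intro c
    obtain ⟨v, rfl⟩ := toComponent_surjective c
    by_cases h : G.toComponent A v = p
    · exact ⟨none, h.symm⟩
    · exact ⟨some (G.toComponent _ v), merge_apply _ h⟩
  simpa [k, Finite.card_option] using Nat.card_le_card_of_surjective _ hr

theorem card_le_k_add_ncard [Finite E] (G : RibbonGraph V E) (A : Set E) :
    Nat.card V ≤ G.k A + A.ncard := by
  induction A, A.toFinite using Set.Finite.induction_on with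
  | empty => simp [k_empty]
  | @insert e A he _ ih =>
    rw [Set.ncard_insert_of_notMem he]
    have := G.k_le_k_insert_add_one A e
    omega

end Components

section Cycles

variable {G : RibbonGraph V E} {A B : Set E} {e : E} {u w : V}

theorem isForest_empty (G : RibbonGraph V E) : G.IsForest ∅ :=
  fun ⟨_, _, _, _, _, h⟩ => (h 0).1

theorem IsForest.subset (hB : G.IsForest B) (h : A ⊆ B) : G.IsForest A :=
  fun ⟨n, v, e, hv, he, hl⟩ => hB ⟨n, v, e, hv, he, fun i => ⟨h (hl i).1, (hl i).2⟩⟩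

/-- The simple graph on `V` in which distinct vertices are adjacent if an edge in `A` joins them.
It provides the paths of `(V, A)`. -/
def simpleGraph (G : RibbonGraph V E) (A : Set E) : SimpleGraph V where
  Adj u v := u ≠ v ∧ ∃ e ∈ A, G.IsLink e u v
  symm := ⟨fun _ _ ⟨hne, e, he, hl⟩ => ⟨hne.symm, e, he, hl.symm⟩⟩
  loopless := ⟨fun _ h => h.1 rfl⟩

theorem reachable_of_toComponent_eq (h : G.toComponent A u = G.toComponent A w) :
    (G.simpleGraph A).Reachable u w := by
  replace h := Quot.eqvGen_exact h
  induction h with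
  | rel u v h =>
    by_cases huv : u = v
    · rw [huv]
    · exact SimpleGraph.Adj.reachable ⟨huv, h⟩
  | refl => rfl
  | symm _ _ _ ih => exact ih.symm
  | trans _ _ _ _ _ ih₁ ih₂ => exact ih₁.trans ih₂

theorem exists_path_of_toComponent_eq (h : G.toComponent A u = G.toComponent A w) :
    ∃ (n : ℕ) (v : Fin (n + 1) → V) (e : Fin n → E), Function.Injective v ∧
      v 0 = u ∧ v (Fin.last n) = w ∧ ∀ i, e i ∈ A ∧ G.IsLink (e i) (v i.castSucc) (v i.succ) := by
  classical
  obtain ⟨p, hp⟩ := (reachable_of_toComponent_eq h).exists_isPath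
  have hedge (i : Fin p.length) :
      ∃ e ∈ A, G.IsLink e (p.getVert i) (p.getVert (i + 1)) := (p.adj_getVert_succ i.2).2
  choose e he using hedge
  exact ⟨p.length, fun i => p.getVert i, e,
    fun i j hij => Fin.ext (hp.getVert_injOn i.is_le j.is_le hij),
    p.getVert_zero, p.getVert_length, he⟩

theorem injective_of_isLink_path {n : ℕ} {v : Fin (n + 1) → V} {e : Fin n → E}
    (hv : Function.Injective v) (hl : ∀ i, G.IsLink (e i) (v i.castSucc) (v i.succ)) :
    Function.Injective e := by
  intro i j hij
  have hpair := (hl i).sym2_eq (hij ▸ hl j)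
  rw [Sym2.eq_iff, hv.eq_iff, hv.eq_iff, hv.eq_iff, hv.eq_iff] at hpair
  simp only [Fin.ext_iff, Fin.val_castSucc, Fin.val_succ] at hpair ⊢
  omega

theorem EndsJoined.containsCycle_insert (h : G.EndsJoined A e) (he : e ∉ A) :
    G.ContainsCycle (insert e A) := by
  obtain ⟨n, v, g, hv, hv₀, hvn, hg⟩ := exists_path_of_toComponent_eq h
  have hg_ne : e ∉ Set.range g := by
    rintro ⟨i, rfl⟩
    exact he (hg i).1
  have hg_inj := injective_of_isLink_path hv fun i => (hg i).2
  refine ⟨n, v, Fin.snoc g e, hv, Fin.snoc_injective_iff.2 ⟨hg_inj, hg_ne⟩,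
    Fin.lastCases ?_ fun i => ?_⟩
  · rw [Fin.snoc_last, Fin.last_add_one, hv₀, hvn]
    exact ⟨Set.mem_insert e A, G.isLink_vert (e, true, false)⟩
  · rw [Fin.snoc_castSucc, Fin.coeSucc_eq_succ]
    exact ⟨Set.mem_insert_of_mem e (hg i).1, (hg i).2⟩

theorem ContainsCycle.exists_endsJoined_sdiff (h : G.ContainsCycle A) :
    ∃ e ∈ A, G.EndsJoined (A \ {e}) e := by
  obtain ⟨n, v, e, -, he, hl⟩ := h
  have hpath (i : Fin (n + 1)) : G.toComponent (A \ {e (Fin.last n)}) (v 0) =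
      G.toComponent (A \ {e (Fin.last n)}) (v i) := by
    induction i using Fin.induction with
    | zero => rfl
    | succ i ih =>
      obtain ⟨hiA, hi⟩ := hl i.castSucc
      rw [Fin.coeSucc_eq_succ] at hi
      exact ih.trans (hi.toComponent_eq ⟨hiA, fun h => (Fin.castSucc_lt_last i).ne (he h)⟩)
  obtain ⟨hlastA, hlast⟩ := hl (Fin.last n)
  rw [Fin.last_add_one] at hlast
  exact ⟨e (Fin.last n), hlastA, hlast.toComponent_eq_iff.1 (hpath _).symm⟩

end Cycles

section BoundaryStep

variable {A : Set E} {e : E} {x : Corner E}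

theorem boundaryStep_of_mem (h : x.1 ∈ A) : boundaryStep A x = x.alongSide := if_pos h

theorem boundaryStep_of_notMem (h : x.1 ∉ A) : boundaryStep A x = x.alongEnd := if_neg h

theorem boundaryStep_empty (x : Corner E) : boundaryStep ∅ x = x.alongEnd :=
  boundaryStep_of_notMem (Set.notMem_empty x.1)

theorem boundaryStep_fst (A : Set E) (x : Corner E) : (boundaryStep A x).1 = x.1 := by
  unfold boundaryStep
  split_ifs <;> rfl

theorem boundaryStep_involutive (A : Set E) : Function.Involutive (boundaryStep A) := by
  intro x
  by_cases h : x.1 ∈ A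
  · rw [boundaryStep_of_mem h, boundaryStep_of_mem (x := x.alongSide) h]
    simp [Corner.alongSide]
  · rw [boundaryStep_of_notMem h, boundaryStep_of_notMem (x := x.alongEnd) h]
    simp [Corner.alongEnd]

theorem boundaryStep_ne (A : Set E) (x : Corner E) : boundaryStep A x ≠ x := by
  unfold boundaryStep
  split_ifs <;> simp [Corner.alongSide, Corner.alongEnd, Prod.ext_iff]

theorem boundaryStep_insert_of_ne (h : x.1 ≠ e) :
    boundaryStep (insert e A) x = boundaryStep A x := by
  by_cases hx : x.1 ∈ A
  · rw [boundaryStep_of_mem hx, boundaryStep_of_mem (Set.mem_insert_of_mem e hx)]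
  · rw [boundaryStep_of_notMem hx, boundaryStep_of_notMem]
    exact fun hxe => hx (Set.mem_of_mem_insert_of_ne hxe h)

theorem boundaryStep_compl_swap (A : Set E) (x : Corner E) :
    boundaryStep Aᶜ x.swap = (boundaryStep A x).swap := by
  by_cases h : x.1 ∈ A
  · rw [boundaryStep_of_mem h, boundaryStep_of_notMem (not_not.2 h)]
    rfl
  · rw [boundaryStep_of_notMem h, boundaryStep_of_mem (x := x.swap) (A := Aᶜ) h]
    rfl

end BoundaryStep

section BoundaryComponents

/-- The boundary component of `(V, A)` through the corner `x`. -/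
def boundaryAt (G : RibbonGraph V E) (A : Set E) (x : Corner E) : G.BoundaryComponent A :=
  .inl (Quot.mk _ x)

variable {G : RibbonGraph V E} {A : Set E} {e : E}

theorem boundaryAt_arc (x : Corner E) : G.boundaryAt A (G.arc x) = G.boundaryAt A x :=
  congrArg Sum.inl (Quot.sound (.inl rfl)).symm

theorem boundaryAt_boundaryStep (x : Corner E) :
    G.boundaryAt A (boundaryStep A x) = G.boundaryAt A x :=
  congrArg Sum.inl (Quot.sound (.inr rfl)).symm

/-- The universal property of the set of boundary components: a map out of it amounts to a function
`φ` of corners that is constant along the boundary and a function `ψ` of isolated vertices. -/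
def boundaryLift {γ : Type*} (φ : Corner E → γ) (harc : ∀ x, φ (G.arc x) = φ x)
    (hstep : ∀ x, φ (boundaryStep A x) = φ x) (ψ : {v : V // v ∉ Set.range G.vert} → γ) :
    G.BoundaryComponent A → γ :=
  Sum.elim (Quot.lift φ (by rintro x _ (rfl | rfl); exacts [(harc x).symm, (hstep x).symm])) ψ

/-- The vertex disc of which a boundary component of the edgeless surface `(V, ∅)` is the boundary
circle. -/
def boundaryEmptyToVertex (G : RibbonGraph V E) : G.BoundaryComponent ∅ → V :=
  boundaryLift G.vert G.vert_arc (fun x => by rw [boundaryStep_empty, vert_alongEnd]) Subtype.val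

theorem boundaryEmptyToVertex_bijective : Function.Bijective G.boundaryEmptyToVertex := by
  constructor
  · rintro (⟨⟨x⟩⟩ | ⟨u, hu⟩) (⟨⟨y⟩⟩ | ⟨v, hv⟩) h
    · refine congrArg Sum.inl (Quot.eqvGen_sound ?_)
      simpa only [boundaryStep_empty] using (G.vert_eq_iff x y).1 h
    · exact (hv ⟨x, h⟩).elim
    · exact (hu ⟨y, h.symm⟩).elim
    · exact congrArg Sum.inr (Subtype.ext h)
  · intro v
    by_cases h : v ∈ Set.range G.vert
    · obtain ⟨x, rfl⟩ := h
      exact ⟨G.boundaryAt ∅ x, rfl⟩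
    · exact ⟨.inr ⟨v, h⟩, rfl⟩

/-- The boundary components of the edgeless surface `(V, ∅)` correspond to the vertex discs. With
`boundaryLift`, this describes the maps out of `V`. -/
noncomputable def boundaryEmptyEquiv (G : RibbonGraph V E) : G.BoundaryComponent ∅ ≃ V :=
  Equiv.ofBijective G.boundaryEmptyToVertex boundaryEmptyToVertex_bijective

theorem f_empty (G : RibbonGraph V E) : G.f ∅ = Nat.card V := Nat.card_congr G.boundaryEmptyEquiv

theorem toComponent_vert_boundaryStep (x : Corner E) :
    G.toComponent A (G.vert (boundaryStep A x)) = G.toComponent A (G.vert x) := by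
  by_cases h : x.1 ∈ A
  · rw [boundaryStep_of_mem h]
    exact ((G.isLink_vert x).toComponent_eq h).symm
  · rw [boundaryStep_of_notMem h, vert_alongEnd]

/-- The component of `(V, A)` on which a boundary component lies. -/
def boundaryToComponent (G : RibbonGraph V E) (A : Set E) : G.BoundaryComponent A → G.Component A :=
  boundaryLift (fun x => G.toComponent A (G.vert x)) (fun x => by rw [vert_arc])
    toComponent_vert_boundaryStep fun v => G.toComponent A v

theorem boundaryToComponent_surjective : Function.Surjective (G.boundaryToComponent A) := by
  intro c
  obtain ⟨v, rfl⟩ := toComponent_surjective c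
  by_cases h : v ∈ Set.range G.vert
  · obtain ⟨x, rfl⟩ := h
    exact ⟨G.boundaryAt A x, rfl⟩
  · exact ⟨.inr ⟨v, h⟩, rfl⟩

theorem k_le_f [Finite V] [Finite E] (G : RibbonGraph V E) (A : Set E) : G.k A ≤ G.f A :=
  Nat.card_le_card_of_surjective _ boundaryToComponent_surjective

/-- The boundary curve that leaves a bridge at one corner of an end can only return to it at the
other corner of this end, as the other end lies in a different component of `(V, A)`. -/
theorem boundaryAt_insert_alongEnd [Finite E] {x : Corner E} (hx : ¬ G.EndsJoined A x.1) :
    G.boundaryAt (insert x.1 A) x.alongEnd = G.boundaryAt (insert x.1 A) x := by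
  by_contra hend
  let S : Set (Corner E) := {y | y.1 = x.1}
  let C : Set (Corner E) := {y | G.boundaryAt (insert x.1 A) y = G.boundaryAt (insert x.1 A) x ∧
    G.toComponent A (G.vert y) = G.toComponent A (G.vert x)}
  have hCS : C ∩ S = {x} := by
    refine Set.eq_singleton_iff_unique_mem.2 ⟨⟨⟨rfl, rfl⟩, rfl⟩, ?_⟩
    rintro y ⟨⟨hy, hyc⟩, hyx⟩
    have hother : G.toComponent A (G.vert x.alongSide) ≠ G.toComponent A (G.vert x) := fun h =>
      hx ((G.isLink_vert x).toComponent_eq_iff.1 h.symm)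
    rcases Corner.eq_or_eq_of_fst_eq hyx with rfl | rfl | rfl | rfl
    · rfl
    · exact (hend hy).elim
    · exact (hother hyc).elim
    · rw [vert_alongEnd] at hyc
      exact (hother hyc).elim
  have harc : Set.MapsTo G.arc C C := fun y hy =>
    ⟨(boundaryAt_arc y).trans hy.1, by rw [vert_arc, hy.2]⟩
  have hstep : Set.MapsTo (boundaryStep A) (C \ S) (C \ S) := fun y ⟨hy, hyS⟩ => by
    refine ⟨⟨?_, (toComponent_vert_boundaryStep y).trans hy.2⟩, ?_⟩
    · rw [← boundaryStep_insert_of_ne hyS, boundaryAt_boundaryStep, hy.1]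
    · exact fun h => hyS ((boundaryStep_fst A y).symm.trans h)
  have heven := even_ncard_inter_of_involutive_of_ne C.toFinite S G.arc_arc G.arc_ne harc
    (boundaryStep_involutive A) (boundaryStep_ne A) hstep
  rw [hCS, Set.ncard_singleton] at heven
  exact absurd heven (by decide)

theorem boundaryAt_insert_boundaryStep [Finite E] (he : e ∉ A) (hne : ¬ G.EndsJoined A e)
    (x : Corner E) :
    G.boundaryAt (insert e A) (boundaryStep A x) = G.boundaryAt (insert e A) x := by
  by_cases hx : x.1 = e
  · subst hx
    rw [boundaryStep_of_notMem he, boundaryAt_insert_alongEnd hne]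
  · rw [← boundaryStep_insert_of_ne hx, boundaryAt_boundaryStep]

theorem f_insert_lt [Finite V] [Finite E] (he : e ∉ A) (hne : ¬ G.EndsJoined A e) :
    G.f (insert e A) < G.f A := by
  let q : G.BoundaryComponent A → G.BoundaryComponent (insert e A) :=
    boundaryLift (G.boundaryAt _) boundaryAt_arc (boundaryAt_insert_boundaryStep he hne) Sum.inr
  have hq : Function.Surjective q := by
    rintro (⟨⟨x⟩⟩ | v)
    · exact ⟨G.boundaryAt A x, rfl⟩
    · exact ⟨.inr v, rfl⟩
  let x : Corner E := (e, false, false)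
  have hx : q (G.boundaryAt A x) = q (G.boundaryAt A x.alongSide) := by
    change G.boundaryAt _ x = G.boundaryAt _ x.alongSide
    rw [← boundaryStep_of_mem (A := insert e A) (Set.mem_insert e A), boundaryAt_boundaryStep]
  exact natCard_lt_of_surjective_not_injective hq fun hinj =>
    hne (congrArg (G.boundaryToComponent A) (hinj hx))

end BoundaryComponents

section Forests

variable {G : RibbonGraph V E} [Finite V] [Finite E] {A B : Set E}

theorem IsForest.f_add_ncard_le (hA : G.IsForest A) : G.f A + A.ncard ≤ Nat.card V := by
  induction A, A.toFinite using Set.Finite.induction_on with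
  | empty => simp [f_empty]
  | @insert e A he _ ih =>
    have := ih (hA.subset (Set.subset_insert e A))
    have := f_insert_lt he fun h => hA (h.containsCycle_insert he)
    rw [Set.ncard_insert_of_notMem he]
    omega

theorem isForest_iff_k_add_ncard : G.IsForest A ↔ G.k A + A.ncard = Nat.card V := by
  constructor
  · intro hA
    have := hA.f_add_ncard_le
    have := G.k_le_f A
    have := G.card_le_k_add_ncard A
    omega
  · intro h hcycle
    obtain ⟨e, he, hj⟩ := hcycle.exists_endsJoined_sdiff
    have : G.k (A \ {e}) ≤ G.k A := k_le_of_endsJoined fun e' he' => by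
      by_cases hee : e' = e
      · rwa [hee]
      · exact endsJoined_of_mem ⟨he', hee⟩
    have := G.card_le_k_add_ncard (A \ {e})
    have := Set.ncard_sdiff_singleton_add_one he
    omega

theorem IsForest.insert_of_not_endsJoined {e : E} (hA : G.IsForest A) (he : ¬ G.EndsJoined A e) :
    G.IsForest (insert e A) := by
  rw [isForest_iff_k_add_ncard] at hA ⊢
  have := k_insert_lt he
  have := G.card_le_k_add_ncard (insert e A)
  have := Set.ncard_insert_le e A
  omega

theorem maximal_isForest_iff :
    Maximal G.IsForest B ↔ G.IsForest B ∧ G.k B = G.k Set.univ := by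
  refine ⟨fun h => ⟨h.prop, ?_⟩, fun ⟨hB, hk⟩ => ⟨hB, fun B' hB' hle => ?_⟩⟩
  · refine le_antisymm (k_le_of_endsJoined fun e _ => ?_) (k_anti (Set.subset_univ B))
    by_contra he
    exact he (endsJoined_of_mem
      (h.le_of_ge (h.prop.insert_of_not_endsJoined he) (Set.subset_insert e B)
        (Set.mem_insert e B)))
  · have hB_card := isForest_iff_k_add_ncard.1 hB
    have hB'_card := isForest_iff_k_add_ncard.1 hB'
    have : G.k B ≤ G.k B' := hk.trans_le (k_anti (Set.subset_univ B'))
    exact (Set.eq_of_subset_of_ncard_le hle (by omega)).ge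

end Forests

theorem cycleMatroid_feasible_nonempty [Finite E] (G : RibbonGraph V E) :
    G.cycleMatroid.feasible.Nonempty := by
  obtain ⟨B, -, hB⟩ := (Set.toFinite {A | G.IsForest A}).exists_le_maximal G.isForest_empty
  exact ⟨B, hB⟩

section QuasiTrees

variable {G : RibbonGraph V E} [Finite V] [Finite E] {A : Set E}

theorem k_eq_of_mem_deltaMatroid (h : A ∈ G.deltaMatroid.feasible) : G.k A = G.k Set.univ :=
  le_antisymm ((G.k_le_f A).trans_eq h) (k_anti (Set.subset_univ A))

theorem card_le_of_mem_deltaMatroid (h : A ∈ G.deltaMatroid.feasible) :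
    Nat.card V ≤ G.k Set.univ + A.ncard :=
  k_eq_of_mem_deltaMatroid h ▸ G.card_le_k_add_ncard A

theorem mem_cycleMatroid_iff : A ∈ G.cycleMatroid.feasible ↔
    A ∈ G.deltaMatroid.feasible ∧ G.k Set.univ + A.ncard = Nat.card V := by
  refine maximal_isForest_iff.trans ⟨fun ⟨hA, hk⟩ => ?_, fun ⟨hA, hcard⟩ => ?_⟩
  · have hcard := isForest_iff_k_add_ncard.1 hA
    have := hA.f_add_ncard_le
    have := G.k_le_f A
    exact ⟨show G.f A = _ by omega, hk ▸ hcard⟩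
  · have hk := k_eq_of_mem_deltaMatroid hA
    exact ⟨isForest_iff_k_add_ncard.2 (hk ▸ hcard), hk⟩

theorem lower_deltaMatroid (G : RibbonGraph V E) : G.deltaMatroid.lower = G.cycleMatroid := by
  obtain ⟨B, hB⟩ := G.cycleMatroid_feasible_nonempty
  obtain ⟨hBf, hBc⟩ := mem_cycleMatroid_iff.1 hB
  ext A
  rw [mem_cycleMatroid_iff]
  refine and_congr_right fun hA => ⟨fun h => ?_, fun h F hF => ?_⟩
  · have := h B hBf
    have := card_le_of_mem_deltaMatroid hA
    omega
  · have := card_le_of_mem_deltaMatroid hF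
    omega

end QuasiTrees

section Dual

theorem range_vert_dual (G : RibbonGraph V E) : Set.range G.dual.vert = Set.range Sum.inl := by
  ext c
  constructor
  · rintro ⟨x, rfl⟩
    exact ⟨_, rfl⟩
  · rintro ⟨⟨x⟩, rfl⟩
    exact ⟨x.swap, rfl⟩

/-- The boundary curves of `(V, A)` are those of `(V(G*), E \ A)` with corners swapped, and the
isolated vertices of `G` are those of `G*`. -/
def boundaryDualEquiv (G : RibbonGraph V E) (A : Set E) :
    G.BoundaryComponent A ≃ G.dual.BoundaryComponent Aᶜ :=
  Equiv.sumCongr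
    (Quot.congr (Function.Involutive.toPerm Corner.swap Corner.swap_swap) fun x y => by
      have hinj := Function.Involutive.injective (Corner.swap_swap (E := E))
      change _ ↔ y.swap = (G.arc x).swap ∨ y.swap = boundaryStep Aᶜ x.swap
      rw [boundaryStep_compl_swap, hinj.eq_iff, hinj.eq_iff])
    ((Equiv.Set.rangeInr _ _).symm.trans (Equiv.setCongr (t := (Set.range G.dual.vert)ᶜ)
      (by rw [range_vert_dual, Set.compl_range_inl])))

theorem f_dual_compl (G : RibbonGraph V E) (A : Set E) : G.dual.f Aᶜ = G.f A :=
  (Nat.card_congr (G.boundaryDualEquiv A)).symm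

/-- The component of `G*` that contains the boundary components of `G` along the vertex `v`. -/
noncomputable def vertToDualComponent (G : RibbonGraph V E) (v : V) :
    G.dual.Component Set.univ :=
  boundaryLift (A := ∅) (fun x => G.dual.toComponent Set.univ (G.dual.vert x.swap))
    (fun x => congrArg _ (G.dual.vert_arc x.swap))
    (fun x => by
      rw [boundaryStep_empty]
      exact ((G.dual.isLink_vert x.swap).toComponent_eq (Set.mem_univ _)).symm)
    (fun v => G.dual.toComponent Set.univ (.inr v)) (G.boundaryEmptyEquiv.symm v)

theorem vertToDualComponent_vert (G : RibbonGraph V E) (x : Corner E) :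
    G.vertToDualComponent (G.vert x) = G.dual.toComponent Set.univ (G.boundaryAt Set.univ x) := by
  have h : G.boundaryEmptyEquiv.symm (G.vert x) = G.boundaryAt ∅ x :=
    G.boundaryEmptyEquiv.symm_apply_apply (G.boundaryAt ∅ x)
  rw [vertToDualComponent, h]
  rfl

theorem vertToDualComponent_isolated (G : RibbonGraph V E) (v : {v : V // v ∉ Set.range G.vert}) :
    G.vertToDualComponent v = G.dual.toComponent Set.univ (.inr v) := by
  have h : G.boundaryEmptyEquiv.symm v = .inr v :=
    G.boundaryEmptyEquiv.symm_apply_apply (.inr v)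
  rw [vertToDualComponent, h]
  rfl

/-- `G` and `G*` have the same components: walking along ends stays on a vertex of `G` and changes
the vertex of `G*` within its component, and walking along sides does the converse. -/
noncomputable def componentDualEquiv (G : RibbonGraph V E) :
    G.Component Set.univ ≃ G.dual.Component Set.univ where
  toFun := Quot.lift G.vertToDualComponent (by
    rintro _ _ ⟨e, -, i, rfl, rfl⟩
    rw [vertToDualComponent_vert, vertToDualComponent_vert]
    exact congrArg _ (G.dual.vert_alongEnd (e, false, i)).symm)
  invFun := Quot.lift (G.boundaryToComponent Set.univ) (by
    rintro _ _ ⟨e, -, i, rfl, rfl⟩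
    exact congrArg (G.toComponent _) (G.vert_alongEnd (e, false, i)).symm)
  left_inv := by
    rintro ⟨v⟩
    by_cases h : v ∈ Set.range G.vert
    · obtain ⟨x, rfl⟩ := h
      exact congrArg _ (G.vertToDualComponent_vert x)
    · exact congrArg _ (G.vertToDualComponent_isolated ⟨v, h⟩)
  right_inv := by
    rintro ⟨⟨⟨x⟩⟩ | v⟩
    · exact G.vertToDualComponent_vert x
    · exact G.vertToDualComponent_isolated v

theorem k_dual (G : RibbonGraph V E) : G.dual.k Set.univ = G.k Set.univ :=
  (Nat.card_congr G.componentDualEquiv).symm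

theorem dual_deltaMatroid (G : RibbonGraph V E) : G.dual.deltaMatroid = G.deltaMatroid.dual := by
  ext A
  rw [SetSystem.mem_dual_feasible]
  change G.dual.f A = G.dual.k _ ↔ G.f Aᶜ = G.k _
  rw [← G.f_dual_compl, compl_compl, k_dual]

theorem upper_deltaMatroid [Finite V] [Finite E] (G : RibbonGraph V E) :
    G.deltaMatroid.upper = G.dual.cycleMatroid.dual := by
  rw [← lower_deltaMatroid, dual_deltaMatroid, SetSystem.lower_dual, SetSystem.dual_dual]

end Dual

section EulerGenus

variable {G : RibbonGraph V E} [Finite V] [Finite E]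

theorem eulerGenus_eq_ncard_sub_ncard {A B : Set E} (hA : A ∈ G.deltaMatroid.lower.feasible)
    (hB : B ∈ G.deltaMatroid.upper.feasible) : G.eulerGenus = B.ncard - A.ncard := by
  rw [lower_deltaMatroid, mem_cycleMatroid_iff] at hA
  rw [upper_deltaMatroid, SetSystem.mem_dual_feasible, mem_cycleMatroid_iff, k_dual] at hB
  have := hA.2
  have hB_card : G.k Set.univ + Bᶜ.ncard = G.f Set.univ := hB.2
  have := Set.ncard_add_ncard_compl B
  unfold eulerGenus
  omega

theorem isPlane_iff_forall_ncard_eq : G.IsPlane ↔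
    ∀ X ∈ G.deltaMatroid.feasible, ∀ Y ∈ G.deltaMatroid.feasible, X.ncard = Y.ncard := by
  obtain ⟨A, hA⟩ : G.deltaMatroid.lower.feasible.Nonempty :=
    G.lower_deltaMatroid ▸ G.cycleMatroid_feasible_nonempty
  obtain ⟨T, hT⟩ := G.dual.cycleMatroid_feasible_nonempty
  have hB : Tᶜ ∈ G.deltaMatroid.upper.feasible := by
    rwa [upper_deltaMatroid, SetSystem.mem_dual_feasible, compl_compl]
  have hgenus := eulerGenus_eq_ncard_sub_ncard hA hB
  unfold IsPlane
  constructor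
  · intro hplane X hX Y hY
    have := hA.2 X hX
    have := hA.2 Y hY
    have := hB.2 X hX
    have := hB.2 Y hY
    omega
  · intro h
    have := h A hA.1 Tᶜ hB.1
    omega

end EulerGenus

end RibbonGraph

theorem corollaryc {V E : Type*} [Finite V] [Finite E] (G : RibbonGraph V E) :
    G.deltaMatroid.lower = G.cycleMatroid ∧
    G.deltaMatroid.upper = G.dual.cycleMatroid.dual ∧
    (G.deltaMatroid = G.cycleMatroid ↔ G.IsPlane) ∧
    (¬ G.IsPlane → ¬ G.deltaMatroid.IsMatroid) := by
  refine ⟨G.lower_deltaMatroid, G.upper_deltaMatroid, ?_, ?_⟩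
  · rw [← G.lower_deltaMatroid, eq_comm, SetSystem.lower_eq_self_iff,
      RibbonGraph.isPlane_iff_forall_ncard_eq]
  · exact mt fun h => RibbonGraph.isPlane_iff_forall_ncard_eq.2 h.2
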